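/- Let $E$ be a nonzero complex Banach space and $L$ a finite-dimensional complex solvable Lie algebra acting on $E$ by right continuous operators, that is, there is given a homomorphism of complex Lie algebras from $L$ to the algebra $\mathcal L(E)$ of bounded linear operators on $E$ with the opposite product (for instance the inclusion, when $L$ is a Lie subalgebra of $\mathcal L(E)$ with the opposite product). Write $e\cdot x$ for the action of $x\in L$ on $e\in E$; thus $e\cdot[x,y]=(e\cdot x)\cdot y-(e\cdot y)\cdot x$. For a linear form $f\in L^*$ with $f([L,L])=0$ let $(E\otimes\wedge^{*}L,d(f))$ be the chain complex whose boundary $E\otimes\wedge^pL\to E\otimes\wedge^{p-1}L$, $p\ge 1$, is $$e\otimes x_1\wedge\cdots\wedge x_p\mapsto\sum_{k=1}^p(-1)^{k+1}\bigl(e\cdot x_k-f(x_k)e\bigr)\otimes x_1\wedge\cdots\hat x_k\cdots\wedge x_p+\sum_{1\le k<l\le p}(-1)^{k+l}\,e\otimes[x_k,x_l]\wedge x_1\wedge\cdots\hat x_k\cdots\hat x_l\cdots\wedge x_p,$$ and let $H_*(L,E\otimes\mathbb C(f))$ be its homology. Let $$Sp(L,E)=\{f\in L^*: f([L,L])=0,\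 H_*(L,E\otimes\mathbb C(f))\neq 0\}.$$ Then $Sp(L,E)$ is not empty. -/

import Mathlib

open scoped TensorProduct

attribute [local instance 100] LieRing.ofAssociativeRing

noncomputable section

namespace LieSpectrum

section Exterior

variable (L : Type*) [LieRing L] [LieAlgebra ℂ L]

/-- The linear map `⋀^{n+1} L → L ⊗ ⋀^n L` sending `x₀ ∧ ⋯ ∧ xₙ` to
`∑ₖ (-1)^k xₖ ⊗ (x₀ ∧ ⋯ x̂ₖ ⋯ ∧ xₙ)`; see `split_ιMulti`. -/
def split (n : ℕ) : ⋀[ℂ]^(n + 1) L →ₗ[ℂ] L ⊗[ℂ] ⋀[ℂ]^n L :=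
  exteriorPower.alternatingMapLinearEquiv
    (AlternatingMap.alternatizeUncurryFin
      { toFun := fun x ↦ (TensorProduct.mk ℂ L (⋀[ℂ]^n L) x).compAlternatingMap
          (exteriorPower.ιMulti ℂ n)
        map_add' := fun x y ↦ by ext u; simp
        map_smul' := fun c x ↦ by ext u; simp [TensorProduct.smul_tmul'] })

theorem split_ιMulti (n : ℕ) (x : Fin (n + 1) → L) :
    split L n (exteriorPower.ιMulti ℂ (n + 1) x) =
      ∑ k : Fin (n + 1), (-1 : ℤ) ^ (k : ℕ) •
        (x k ⊗ₜ[ℂ] exteriorPower.ιMulti ℂ n (k.removeNth x)) := by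
  simp [split, AlternatingMap.alternatizeUncurryFin_apply]

/-- The trilinear expression `(x, y, u) ↦ [x, y] ∧ u₁ ∧ ⋯ ∧ uₘ`, alternating in `u`. -/
def bracketWedge (m : ℕ) : L →ₗ[ℂ] L →ₗ[ℂ] L [⋀^Fin m]→ₗ[ℂ] ⋀[ℂ]^(m + 1) L :=
  (LieModule.toEnd ℂ L L : L →ₗ[ℂ] Module.End ℂ L).compr₂
    (AlternatingMap.curryLeft (exteriorPower.ιMulti ℂ (m + 1)))

@[simp]
theorem bracketWedge_apply (m : ℕ) (x y : L) (u : Fin m → L) :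
    bracketWedge L m x y u = exteriorPower.ιMulti ℂ (m + 1) (Matrix.vecCons ⁅x, y⁆ u) := rfl

/-- The Lie algebra boundary with trivial coefficients `⋀^{n+1} L → ⋀^n L`: zero for `n = 0`, and
`x₀ ∧ ⋯ ∧ xₙ ↦ ∑_{k<l} (-1)^{k+l} [xₖ, xₗ] ∧ x₀ ∧ ⋯ x̂ₖ ⋯ x̂ₗ ⋯ ∧ xₙ` in general.
The alternating sum below runs over ordered pairs, so each pair `k < l` occurs twice, whence
the factor `1/2`; the usual formula is `bracketBoundary_ιMulti`. -/
def bracketBoundary : (n : ℕ) → ⋀[ℂ]^(n + 1) L →ₗ[ℂ] ⋀[ℂ]^n L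
  | 0 => 0
  | m + 1 => exteriorPower.alternatingMapLinearEquiv
      (-(1 / 2 : ℂ) • AlternatingMap.alternatizeUncurryFin
        (AlternatingMap.alternatizeUncurryFinLM ∘ₗ bracketWedge L m))

theorem bracketBoundary_zero : bracketBoundary L 0 = 0 := rfl

/-- The pair `k < l` is encoded as `k = i.castSucc`, `l = j.succ` with `i ≤ j`, and
`j.removeNth (i.castSucc.removeNth x)` is `x` with the entries `k` and `l` deleted. -/
theorem bracketBoundary_ιMulti (m : ℕ) (x : Fin (m + 2) → L) :
    bracketBoundary L (m + 1) (exteriorPower.ιMulti ℂ (m + 2) x) =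
      ∑ i : Fin (m + 1), ∑ j ≥ i, (-1 : ℤ) ^ ((i.castSucc : ℕ) + (j.succ : ℕ)) •
        exteriorPower.ιMulti ℂ (m + 1)
          (Matrix.vecCons ⁅x i.castSucc, x j.succ⁆ (j.removeNth (i.castSucc.removeNth x))) := by
  simp only [bracketBoundary, exteriorPower.alternatingMapLinearEquiv_apply_ιMulti,
    AlternatingMap.smul_apply,
    AlternatingMap.alternatizeUncurryFin_alternatizeUncurryFinLM_comp_apply, bracketWedge_apply,
    Finset.smul_sum]
  refine Finset.sum_congr rfl fun i _ ↦ Finset.sum_congr rfl fun j _ ↦ ?_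
  have h : exteriorPower.ιMulti ℂ (m + 1)
      (Matrix.vecCons ⁅x j.succ, x i.castSucc⁆ (j.removeNth (i.castSucc.removeNth x))) =
      -exteriorPower.ιMulti ℂ (m + 1)
      (Matrix.vecCons ⁅x i.castSucc, x j.succ⁆ (j.removeNth (i.castSucc.removeNth x))) := by
    rw [← lie_skew, ← neg_one_smul ℂ ⁅x i.castSucc, _⁆, AlternatingMap.map_vecCons_smul,
      neg_one_smul]
  rw [h, sub_neg_eq_add, ← two_smul ℂ, smul_comm _ ((-1 : ℤ) ^ _), smul_smul]
  simp only [Fin.val_castSucc, Fin.val_succ, ← add_assoc, pow_succ, mul_smul]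
  simp only [smul_smul]
  norm_num

end Exterior

variable {L : Type*} [LieRing L] [LieAlgebra ℂ L]
variable {E : Type*} [NormedAddCommGroup E] [NormedSpace ℂ E]

/-- The bilinear map `(e, x) ↦ e · x - f(x) e` on `E ⊗ L`, where the right action `e · x` of `L` on
`E` is given by a Lie algebra homomorphism `ρ` into the bounded operators with the opposite
product, `e · x = ρ(x) e`. -/
def twistedAction (ρ : L →ₗ⁅ℂ⁆ (E →L[ℂ] E)ᵐᵒᵖ) (f : Module.Dual ℂ L) : E ⊗[ℂ] L →ₗ[ℂ] E :=
  TensorProduct.lift (LinearMap.mk₂ ℂ (fun (e : E) (x : L) ↦ (ρ x).unop e - f x • e)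
    (fun e e' x ↦ by simp only [map_add, smul_add]; abel)
    (fun c e x ↦ by simp only [map_smul, smul_sub, smul_comm c])
    (fun e x y ↦ by simp only [map_add, MulOpposite.unop_add, add_apply, add_smul]; abel)
    (fun c e x ↦ by
      simp only [map_smul, MulOpposite.unop_smul, smul_apply, smul_sub, smul_assoc]))

@[simp]
theorem twistedAction_tmul (ρ : L →ₗ⁅ℂ⁆ (E →L[ℂ] E)ᵐᵒᵖ) (f : Module.Dual ℂ L) (e : E) (x : L) :
    twistedAction ρ f (e ⊗ₜ x) = (ρ x).unop e - f x • e := rfl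

/-- The boundary `d(f) : E ⊗ ⋀^{n+1} L → E ⊗ ⋀^n L` of the complex `(E ⊗ ⋀ L, d(f))`; the usual
formulas are `boundary_zero_tmul` and `boundary_succ_tmul`. -/
def boundary (ρ : L →ₗ⁅ℂ⁆ (E →L[ℂ] E)ᵐᵒᵖ) (f : Module.Dual ℂ L) (n : ℕ) :
    E ⊗[ℂ] ⋀[ℂ]^(n + 1) L →ₗ[ℂ] E ⊗[ℂ] ⋀[ℂ]^n L :=
  (twistedAction ρ f).rTensor (⋀[ℂ]^n L) ∘ₗ
      (TensorProduct.assoc ℂ E L (⋀[ℂ]^n L)).symm.toLinearMap ∘ₗ (split L n).lTensor E +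
    (bracketBoundary L n).lTensor E

theorem boundary_zero_tmul (ρ : L →ₗ⁅ℂ⁆ (E →L[ℂ] E)ᵐᵒᵖ) (f : Module.Dual ℂ L) (e : E)
    (x : Fin 1 → L) :
    boundary ρ f 0 (e ⊗ₜ exteriorPower.ιMulti ℂ 1 x) =
      ((ρ (x 0)).unop e - f (x 0) • e) ⊗ₜ exteriorPower.ιMulti ℂ 0 Fin.elim0 := by
  have : (Fin.removeNth 0 x : Fin 0 → L) = Fin.elim0 := Subsingleton.elim _ _
  simp [boundary, split_ιMulti, bracketBoundary_zero, this]

theorem boundary_succ_tmul (ρ : L →ₗ⁅ℂ⁆ (E →L[ℂ] E)ᵐᵒᵖ) (f : Module.Dual ℂ L) (m : ℕ) (e : E)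
    (x : Fin (m + 2) → L) :
    boundary ρ f (m + 1) (e ⊗ₜ exteriorPower.ιMulti ℂ (m + 2) x) =
      ∑ k : Fin (m + 2), (-1 : ℤ) ^ (k : ℕ) •
        (((ρ (x k)).unop e - f (x k) • e) ⊗ₜ[ℂ] exteriorPower.ιMulti ℂ (m + 1) (k.removeNth x)) +
      ∑ i : Fin (m + 1), ∑ j ≥ i, (-1 : ℤ) ^ ((i.castSucc : ℕ) + (j.succ : ℕ)) •
        (e ⊗ₜ[ℂ] exteriorPower.ιMulti ℂ (m + 1)
          (Matrix.vecCons ⁅x i.castSucc, x j.succ⁆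
            (j.removeNth (i.castSucc.removeNth x)))) := by
  simp only [boundary, LinearMap.add_apply, LinearMap.comp_apply, LinearMap.lTensor_tmul,
    split_ιMulti, bracketBoundary_ιMulti, TensorProduct.tmul_sum, TensorProduct.tmul_smul,
    map_sum, map_zsmul, LinearEquiv.coe_coe, TensorProduct.assoc_symm_tmul,
    LinearMap.rTensor_tmul, twistedAction_tmul]

/-- The cycles in `E ⊗ ⋀^q L`; the boundary vanishes in degree `0`. -/
def cycles (ρ : L →ₗ⁅ℂ⁆ (E →L[ℂ] E)ᵐᵒᵖ) (f : Module.Dual ℂ L) :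
    (q : ℕ) → Submodule ℂ (E ⊗[ℂ] ⋀[ℂ]^q L)
  | 0 => ⊤
  | n + 1 => LinearMap.ker (boundary ρ f n)

/-- The homology `H_q(L, E ⊗ ℂ(f))` of the complex `(E ⊗ ⋀ L, d(f))`: cycles modulo boundaries. -/
abbrev Homology (ρ : L →ₗ⁅ℂ⁆ (E →L[ℂ] E)ᵐᵒᵖ) (f : Module.Dual ℂ L) (q : ℕ) : Type _ :=
  cycles ρ f q ⧸ (LinearMap.range (boundary ρ f q)).submoduleOf (cycles ρ f q)

/-- The joint spectrum `Sp(L, E)`: the linear forms `f` on `L` which vanish on `[L, L]` and for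
which `H_*(L, E ⊗ ℂ(f))` is nonzero. -/
def jointSpectrum (ρ : L →ₗ⁅ℂ⁆ (E →L[ℂ] E)ᵐᵒᵖ) : Set (Module.Dual ℂ L) :=
  {f | (∀ x y : L, f ⁅x, y⁆ = 0) ∧ ∃ q : ℕ, Nontrivial (Homology ρ f q)}

end LieSpectrum

end

/-!
The homology is already nonzero in degree `0` for a suitable character `f`. Up to the canonical
identification `E ⊗ ⋀⁰ L = E`, the image of the last boundary is `∑ₓ (ρ(x) - f(x)) E`. If it were
all of `E`, the open mapping theorem would bound every `φ ∈ E*` by a constant times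
`maxᵢ ‖φ ∘ (ρ(xᵢ) - f(xᵢ))‖`, for a basis `(xᵢ)` of `L`. So it suffices that the transposed
operators `φ ↦ φ ∘ ρ(x)` on `E*`, which form a left representation of `L`, have approximate common
eigenvectors with eigenvalue `f`.

This is an approximate version of Lie's theorem (`exists_isApproxWeight`), valid for bounded
representations `σ` of a solvable Lie algebra on a nonzero complex Banach space `F`. It is proved
by induction along ideals `I` of codimension one. Replacing `F` by `ℓ^∞(F) / c₀(F)` turns an
approximate common eigenvector for `I` into an exact one (`IsApproxWeight.exists_eigenvector`),
and approximate eigenvectors in the quotient yield approximate eigenvectors in `F`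
(`IsApproxWeight.of_germs`). The common eigenspace `V` of `I` for a weight `f` is invariant under
all of `L` as soon as `f` vanishes on `[L, I]`. In finite dimensions that is a trace argument;
here, with `A = σ(x)`, `B = σ(y) - f(y)` and `c = f([x, y])`, one has `Bᵏ Aᵏ v = k! (-c)ᵏ v` for
`v ∈ V`, so boundedness of `A` and `B` forces `c = 0` (`weight_lie_eq_zero`). Finally an element
spanning `L` modulo `I` acts on the Banach space `V` with an approximate eigenvector, at a frontier
point of its spectrum (`exists_approx_eigenvector`).
-/

open Filter Topology
open scoped BoundedContinuousFunction

namespace LieSpectrum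

/-! ### Approximate eigenvectors of a bounded operator -/

/-- Any frontier point of the spectrum of `A` serves as `μ`: if `A - μ` were bounded below there,
the inverses of `A - ν` would stay bounded as `ν → μ` in the resolvent set, and `A - μ` would be
invertible. -/
theorem exists_approx_eigenvector {V : Type*} [NormedAddCommGroup V] [NormedSpace ℂ V]
    [CompleteSpace V] [Nontrivial V] (A : V →L[ℂ] V) :
    ∃ μ : ℂ, ∀ ε > 0, ∃ v ≠ 0, ‖A v - μ • v‖ ≤ ε * ‖v‖ := by
  have hne : (frontier (spectrum ℂ A)).Nonempty := by
    rw [Set.nonempty_iff_ne_empty, Ne, ← isClopen_iff_frontier_eq_empty, isClopen_iff]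
    rintro (h | h)
    · exact (spectrum.nonempty A).ne_empty h
    · exact NormedSpace.unbounded_univ ℂ ℂ (h ▸ (spectrum.isCompact A).isBounded)
  obtain ⟨μ, hμ⟩ := hne
  refine ⟨μ, fun ε hε ↦ ?_⟩
  by_contra! hlow
  rw [frontier_eq_closure_inter_closure, (spectrum.isClosed A).closure_eq] at hμ
  obtain ⟨hμs, hμc⟩ := hμ
  obtain ⟨ν, hν, hd⟩ := Metric.mem_closure_iff.mp hμc (ε / 2) (by positivity)
  rw [dist_eq_norm] at hd
  have hν' : IsUnit (algebraMap ℂ (V →L[ℂ] V) ν - A) := by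
    simpa [spectrum.mem_iff] using hν
  obtain ⟨u, hu⟩ := hν'
  have hlow' : ∀ v, ε * ‖v‖ ≤ ‖A v - μ • v‖ := fun v ↦ by
    by_cases hv : v = 0
    · simp [hv]
    · exact (hlow v hv).le
  have hinv : ‖(↑u⁻¹ : V →L[ℂ] V)‖ ≤ (ε / 2)⁻¹ := by
    refine ContinuousLinearMap.opNorm_le_bound _ (by positivity) fun w ↦ ?_
    set v := (↑u⁻¹ : V →L[ℂ] V) w with hv
    have hw : ν • v - A v = w := by
      have : ((u : V →L[ℂ] V) * ↑u⁻¹) w = w := by simp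
      rw [hu] at this
      simpa [hv] using this
    have h1 := hlow' v
    have h2 : A v - μ • v = -(μ - ν) • v - w := by
      rw [← hw]
      module
    have h3 : ‖A v - μ • v‖ ≤ ‖μ - ν‖ * ‖v‖ + ‖w‖ := by
      rw [h2]
      refine (norm_sub_le _ _).trans ?_
      rw [norm_smul, norm_neg]
    have h4 : ‖μ - ν‖ * ‖v‖ ≤ ε / 2 * ‖v‖ := by gcongr
    rw [inv_mul_eq_div, le_div_iff₀ (by positivity)]
    linarith
  refine spectrum.mem_iff.mp hμs ?_
  have hclose : ‖(algebraMap ℂ (V →L[ℂ] V) μ - A) - u‖ < ‖(↑u⁻¹ : V →L[ℂ] V)‖⁻¹ := by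
    have h0 : 0 < ‖(↑u⁻¹ : V →L[ℂ] V)‖ := norm_pos_iff.mpr u⁻¹.ne_zero
    calc ‖(algebraMap ℂ (V →L[ℂ] V) μ - A) - u‖ = ‖algebraMap ℂ (V →L[ℂ] V) (μ - ν)‖ := by
          rw [hu, map_sub]; congr 1; abel
      _ = ‖μ - ν‖ := norm_algebraMap' _ _
      _ < ε / 2 := hd
      _ ≤ _ := by
        rw [← inv_inv (ε / 2)]
        exact inv_anti₀ h0 hinv
  exact (u.ofNearby _ hclose).isUnit

/-! ### Bounded sequences modulo null sequences -/

section Germs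

variable (F : Type*) [NormedAddCommGroup F] [NormedSpace ℂ F]

/-- The space `c₀(F)` of null sequences, as a subspace of the bounded sequences in `F`. -/
def nullSeq : Submodule ℂ (ℕ →ᵇ F) where
  carrier := {u | Tendsto u atTop (𝓝 0)}
  add_mem' hu hv := by simpa using! Tendsto.add hu hv
  zero_mem' := tendsto_const_nhds
  smul_mem' c u hu := by simpa using! Tendsto.const_smul hu c

variable {F} in
theorem mem_nullSeq {u : ℕ →ᵇ F} : u ∈ nullSeq F ↔ Tendsto u atTop (𝓝 0) := Iff.rfl

instance isClosed_nullSeq : IsClosed (nullSeq F : Set (ℕ →ᵇ F)) := by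
  refine isClosed_of_closure_subset fun u hu ↦ ?_
  refine Metric.tendsto_nhds.mpr fun ε hε ↦ ?_
  obtain ⟨w, hw, hd⟩ := Metric.mem_closure_iff.mp hu (ε / 2) (by positivity)
  filter_upwards [Metric.tendsto_nhds.mp (mem_nullSeq.mp hw) (ε / 2) (by positivity)] with n hn
  have := dist_triangle (u n) (w n) 0
  have := BoundedContinuousFunction.dist_coe_le_dist (f := u) (g := w) n
  linarith

/-- The Banach space `ℓ^∞(F) / c₀(F)` of bounded sequences in `F` modulo null sequences. -/
abbrev SeqGerm : Type _ := (ℕ →ᵇ F) ⧸ nullSeq F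

variable {F}

/-- Together with `eventually_norm_lt` this says that the norm of the class of `u` is
`limsup ‖uₙ‖`. -/
theorem norm_mk_le_of_eventually {u : ℕ →ᵇ F} {r : ℝ} (hr : 0 ≤ r)
    (h : ∀ᶠ n in atTop, ‖u n‖ ≤ r) : ‖((nullSeq F).mkQ u : SeqGerm F)‖ ≤ r := by
  classical
  let w : ℕ →ᵇ F := BoundedContinuousFunction.ofNormedAddCommGroupDiscrete
    (fun n ↦ if ‖u n‖ ≤ r then u n else 0) r fun n ↦ by split_ifs with h <;> simp [h, hr]
  have hw : (nullSeq F).mkQ u = (nullSeq F).mkQ w := by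
    refine (Submodule.Quotient.eq _).mpr (mem_nullSeq.mpr ?_)
    refine tendsto_const_nhds.congr' ?_
    filter_upwards [h] with n hn
    simp [w, hn]
  rw [hw]
  refine (Submodule.Quotient.norm_mk_le _ w).trans ?_
  refine (BoundedContinuousFunction.norm_le hr).mpr fun n ↦ ?_
  change ‖if ‖u n‖ ≤ r then u n else 0‖ ≤ r
  split_ifs with h <;> simp [h, hr]

theorem eventually_norm_lt {u : ℕ →ᵇ F} {r : ℝ}
    (h : ‖((nullSeq F).mkQ u : SeqGerm F)‖ < r) : ∀ᶠ n in atTop, ‖u n‖ < r := by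
  obtain ⟨w, hw, hlt⟩ := Submodule.Quotient.norm_mk_lt ((nullSeq F).mkQ u) (sub_pos.mpr h)
  have hlt : ‖w‖ < r := by linarith
  have hnull : Tendsto (u - w : ℕ →ᵇ F) atTop (𝓝 0) :=
    (Submodule.Quotient.eq _).mp (hw.symm : (nullSeq F).mkQ u = _)
  filter_upwards [Metric.tendsto_nhds.mp hnull (r - ‖w‖) (sub_pos.mpr hlt)] with n hn
  rw [dist_zero_right] at hn
  have h1 := w.norm_coe_le_norm n
  have h2 : u n = (u - w) n + w n := by simp
  have h3 := norm_add_le ((u - w) n) (w n)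
  rw [h2]
  linarith

/-- The operator on `ℓ^∞(F) / c₀(F)` induced by applying `T` to each term of a sequence. -/
noncomputable def germMap (T : F →L[ℂ] F) : SeqGerm F →L[ℂ] SeqGerm F :=
  (nullSeq F).liftQL ((nullSeq F).mkQL ∘L T.compLeftContinuousBounded ℕ) fun u hu ↦ by
    refine (Submodule.Quotient.mk_eq_zero _).mpr (mem_nullSeq.mpr ?_)
    simpa using! (T.continuous.tendsto 0).comp (mem_nullSeq.mp hu)

@[simp]
theorem germMap_mkQ (T : F →L[ℂ] F) (u : ℕ →ᵇ F) :
    germMap T ((nullSeq F).mkQ u) = (nullSeq F).mkQ (T.compLeftContinuousBounded ℕ u) := rfl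

variable {L : Type*} [LieRing L] [LieAlgebra ℂ L]

/-- The representation on `ℓ^∞(F) / c₀(F)` induced by a representation on `F`. -/
noncomputable def germRep (σ : L →ₗ⁅ℂ⁆ (F →L[ℂ] F)) : L →ₗ⁅ℂ⁆ (SeqGerm F →L[ℂ] SeqGerm F) where
  toFun x := germMap (σ x)
  map_add' x y := by
    refine ContinuousLinearMap.ext fun q ↦ ?_
    obtain ⟨u, rfl⟩ := (nullSeq F).mkQ_surjective q
    simp only [germMap_mkQ, add_apply, ← map_add]
    congr 1
    ext n
    simp
  map_smul' c x := by
    refine ContinuousLinearMap.ext fun q ↦ ?_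
    obtain ⟨u, rfl⟩ := (nullSeq F).mkQ_surjective q
    simp only [germMap_mkQ, smul_apply, RingHom.id_apply, ← map_smul]
    congr 1
    ext n
    simp
  map_lie' {x y} := by
    refine ContinuousLinearMap.ext fun q ↦ ?_
    obtain ⟨u, rfl⟩ := (nullSeq F).mkQ_surjective q
    simp only [germMap_mkQ, Ring.lie_def, sub_apply, mul_apply_eq_comp, ← map_sub]
    congr 1
    ext n
    simp [Ring.lie_def]

@[simp]
theorem germRep_apply (σ : L →ₗ⁅ℂ⁆ (F →L[ℂ] F)) (x : L) : germRep σ x = germMap (σ x) := rfl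

theorem germRep_mkQ_sub_smul (σ : L →ₗ⁅ℂ⁆ (F →L[ℂ] F)) (x : L) (c : ℂ) (u : ℕ →ᵇ F) :
    germRep σ x ((nullSeq F).mkQ u) - c • (nullSeq F).mkQ u =
      (nullSeq F).mkQ ((σ x).compLeftContinuousBounded ℕ u - c • u) := by
  rw [map_sub, map_smul, germRep_apply, germMap_mkQ]

end Germs

/-! ### Approximate weights -/

section ApproxWeight

variable {L : Type*} [LieRing L] [LieAlgebra ℂ L]
variable {F : Type*} [NormedAddCommGroup F] [NormedSpace ℂ F]

/-- The linear form `f` is an approximate weight of the representation `σ` if finitely many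
operators `σ x` always have a common approximate eigenvector with eigenvalues `f x`, up to an
arbitrarily small relative error. -/
def IsApproxWeight (σ : L →ₗ⁅ℂ⁆ (F →L[ℂ] F)) (f : Module.Dual ℂ L) : Prop :=
  ∀ (s : Finset L), ∀ ε > 0, ∃ v : F, v ≠ 0 ∧ ∀ x ∈ s, ‖σ x v - f x • v‖ ≤ ε * ‖v‖

/-- The class of a sequence of better and better approximate eigenvectors is an eigenvector. -/
theorem IsApproxWeight.exists_eigenvector [FiniteDimensional ℂ L]
    {σ : L →ₗ⁅ℂ⁆ (F →L[ℂ] F)} {f : Module.Dual ℂ L} (h : IsApproxWeight σ f) :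
    ∃ q : SeqGerm F, q ≠ 0 ∧ ∀ x, germRep σ x q = f x • q := by
  classical
  let b := Module.finBasis ℂ L
  have hn (n : ℕ) : ∃ v : F, ‖v‖ = 1 ∧ ∀ i, ‖σ (b i) v - f (b i) • v‖ ≤ 1 / ((n : ℝ) + 1) := by
    obtain ⟨v, hv, hs⟩ := h (Finset.univ.image b) (1 / ((n : ℝ) + 1)) (by positivity)
    have hv0 : 0 < ‖v‖ := norm_pos_iff.mpr hv
    refine ⟨((‖v‖⁻¹ : ℝ) : ℂ) • v, ?_, fun i ↦ ?_⟩
    · rw [norm_smul, Complex.norm_real, norm_inv, norm_norm, inv_mul_cancel₀ hv0.ne']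
    · rw [map_smul, smul_comm, ← smul_sub, norm_smul, Complex.norm_real, norm_inv, norm_norm,
        inv_mul_le_iff₀ hv0, mul_comm]
      exact hs _ (by simp)
  choose v hv hvb using hn
  let u : ℕ →ᵇ F := BoundedContinuousFunction.ofNormedAddCommGroupDiscrete v 1 fun n ↦ (hv n).le
  have hu (n : ℕ) : u n = v n := rfl
  refine ⟨(nullSeq F).mkQ u, fun h0 ↦ ?_, fun x ↦ ?_⟩
  · have := (mem_nullSeq.mp ((Submodule.Quotient.mk_eq_zero _).mp h0)).norm
    simp only [hu, hv, norm_zero] at this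
    exact one_ne_zero (tendsto_nhds_unique tendsto_const_nhds this)
  · let l₁ : L →ₗ[ℂ] SeqGerm F :=
      (ContinuousLinearMap.apply ℂ (SeqGerm F) ((nullSeq F).mkQ u)).toLinearMap ∘ₗ
        (germRep σ).toLinearMap
    let l₂ : L →ₗ[ℂ] SeqGerm F := f.smulRight ((nullSeq F).mkQ u)
    suffices l₁ = l₂ from LinearMap.congr_fun this x
    refine b.ext fun i ↦ sub_eq_zero.mp ?_
    change germRep σ (b i) ((nullSeq F).mkQ u) - f (b i) • (nullSeq F).mkQ u = 0
    rw [germRep_mkQ_sub_smul]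
    refine (Submodule.Quotient.mk_eq_zero _).mpr (mem_nullSeq.mpr ?_)
    exact squeeze_zero_norm (fun n ↦ hvb n i) tendsto_one_div_add_atTop_nhds_zero_nat

/-- Far out terms of a representative of an approximate eigenvector in `ℓ^∞(F) / c₀(F)` are
approximate eigenvectors, along a subsequence on which they stay away from `0`. -/
theorem IsApproxWeight.of_germs {σ : L →ₗ⁅ℂ⁆ (F →L[ℂ] F)} {f : Module.Dual ℂ L}
    (h : IsApproxWeight (germRep σ) f) : IsApproxWeight σ f := by
  intro s ε hε
  obtain ⟨q, hq, hs⟩ := h s (ε / 4) (by positivity)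
  obtain ⟨u, rfl⟩ := (nullSeq F).mkQ_surjective q
  set r := ‖((nullSeq F).mkQ u : SeqGerm F)‖
  have hr0 : 0 < r := norm_pos_iff.mpr hq
  have h1 : ∀ᶠ n in atTop, ∀ x ∈ s, ‖σ x (u n) - f x • u n‖ < ε / 2 * r := by
    refine (Finset.eventually_all s).mpr fun x hx ↦ ?_
    refine eventually_norm_lt (u := (σ x).compLeftContinuousBounded ℕ u - f x • u) ?_
    rw [← germRep_mkQ_sub_smul]
    refine (hs x hx).trans_lt ?_
    gcongr
    norm_num
  have h2 : ∃ᶠ n in atTop, r / 2 < ‖u n‖ := by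
    intro hnot
    have := norm_mk_le_of_eventually (u := u) (r := r / 2) (by positivity)
      (hnot.mono fun n hn ↦ not_lt.mp hn)
    linarith
  obtain ⟨n, hn2, hn1⟩ := (h2.and_eventually h1).exists
  refine ⟨u n, fun h0 ↦ ?_, fun x hx ↦ (hn1 x hx).le.trans ?_⟩
  · rw [h0, norm_zero] at hn2
    linarith
  · nlinarith

theorem IsApproxWeight.apply_lie {σ : L →ₗ⁅ℂ⁆ (F →L[ℂ] F)} [FiniteDimensional ℂ L]
    {f : Module.Dual ℂ L} (h : IsApproxWeight σ f) (x y : L) : f ⁅x, y⁆ = 0 := by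
  obtain ⟨q, hq, hqx⟩ := h.exists_eigenvector
  have h1 := hqx ⁅x, y⁆
  rw [LieHom.map_lie, Ring.lie_def, sub_apply, mul_apply_eq_comp,
    mul_apply_eq_comp, hqx, hqx, map_smul, map_smul, hqx, hqx, smul_comm,
    sub_self] at h1
  exact (smul_eq_zero.mp h1.symm).resolve_right hq

/-! ### Lie's theorem for bounded operators -/

/-- The span of `Aʲ v` for `j < k`. -/
def krylov (A : F →L[ℂ] F) (v : F) (k : ℕ) : Submodule ℂ F :=
  Submodule.span ℂ ((fun j ↦ (A ^ j) v) '' Set.Iio k)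

theorem pow_mem_krylov (A : F →L[ℂ] F) (v : F) {j k : ℕ} (h : j < k) : (A ^ j) v ∈ krylov A v k :=
  Submodule.subset_span ⟨j, h, rfl⟩

theorem krylov_mono (A : F →L[ℂ] F) (v : F) {j k : ℕ} (h : j ≤ k) :
    krylov A v j ≤ krylov A v k :=
  Submodule.span_mono (Set.image_mono fun _ hi ↦ lt_of_lt_of_le hi h)

theorem apply_mem_krylov {A : F →L[ℂ] F} {v w : F} {k : ℕ} (h : w ∈ krylov A v k) :
    A w ∈ krylov A v (k + 1) := by
  suffices krylov A v k ≤ (krylov A v (k + 1)).comap A.toLinearMap from this h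
  refine Submodule.span_le.mpr ?_
  rintro _ ⟨j, hj, rfl⟩
  have := pow_mem_krylov A v (Nat.succ_lt_succ hj)
  rwa [pow_succ', mul_apply_eq_comp] at this

/-- Modulo lower powers of `A = σ x`, the operator `σ y - f y` sends `Aᵏ v` to
`-k f([x, y]) Aᵏ⁻¹ v`. -/
theorem apply_pow_sub_mem_krylov (σ : L →ₗ⁅ℂ⁆ (F →L[ℂ] F)) (I : LieIdeal ℂ L)
    (f : Module.Dual ℂ I) {v : F} (hv : ∀ y : I, σ y v = f y • v) (x : L) (k : ℕ) :
    (∀ y : I, σ y ((σ x ^ k) v) - f y • (σ x ^ k) v ∈ krylov (σ x) v k) ∧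
    ∀ y : I, σ y ((σ x ^ (k + 1)) v) - f y • (σ x ^ (k + 1)) v +
      ((k + 1 : ℂ) * f ⁅x, y⁆) • (σ x ^ k) v ∈ krylov (σ x) v k := by
  have hcomm (y : I) (w : F) : σ y (σ x w) = σ x (σ y w) - σ (⁅x, y⁆ : I) w := by
    simp [Ring.lie_def]
  induction k with
  | zero =>
    refine ⟨fun y ↦ ?_, fun y ↦ ?_⟩
    · simp [hv]
    · have h : σ y (σ x v) = f y • σ x v - f ⁅x, y⁆ • v := by rw [hcomm, hv, hv, map_smul]
      simp [h]
  | succ k ih =>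
    obtain ⟨ih1, ih2⟩ := ih
    have h1 (y : I) : σ y ((σ x ^ (k + 1)) v) - f y • (σ x ^ (k + 1)) v ∈
        krylov (σ x) v (k + 1) := by
      have := sub_mem (krylov_mono _ _ (Nat.le_succ k) (ih2 y))
        (Submodule.smul_mem _ ((k + 1 : ℂ) * f ⁅x, y⁆)
          (pow_mem_krylov (σ x) v (Nat.lt_succ_self k)))
      simpa using this
    refine ⟨h1, fun y ↦ ?_⟩
    have h2 := apply_mem_krylov (ih2 y)
    have h3 := h1 ⁅x, y⁆
    have h4 := sub_mem h2 h3
    have hpow : ∀ (j : ℕ) (w : F), (σ x ^ (j + 1)) w = σ x ((σ x ^ j) w) := fun j w ↦ by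
      rw [pow_succ', mul_apply_eq_comp]
    convert h4 using 1
    rw [hpow (k + 1), hcomm]
    simp only [map_add, map_sub, map_smul, ← hpow]
    push_cast
    module

/-- A weight of an ideal `I` on common eigenvectors of `I` vanishes on `[L, I]`. -/
theorem weight_lie_eq_zero (σ : L →ₗ⁅ℂ⁆ (F →L[ℂ] F)) (I : LieIdeal ℂ L)
    (f : Module.Dual ℂ I) {v : F} (hv0 : v ≠ 0) (hv : ∀ y : I, σ y v = f y • v) (x : L) (y : I) :
    f ⁅x, y⁆ = 0 := by
  -- Needed for `‖Bᵏ‖ ≤ ‖B‖ᵏ` at `k = 0`.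
  have : Nontrivial F := ⟨v, 0, hv0⟩
  set A := σ x
  set B : F →L[ℂ] F := σ y - f y • ContinuousLinearMap.id ℂ F with hB
  set c := f ⁅x, y⁆
  have hBw (w : F) : B w = σ y w - f y • w := by simp [hB]
  have hBk (k : ℕ) : ∀ w ∈ krylov A v k, (B ^ k) w = 0 := by
    induction k with
    | zero => intro w hw; simpa [krylov] using hw
    | succ k ih =>
      intro w hw
      suffices krylov A v (k + 1) ≤ (krylov A v k).comap B.toLinearMap by
        rw [pow_succ, mul_apply_eq_comp]
        exact ih _ (this hw)
      refine Submodule.span_le.mpr ?_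
      rintro _ ⟨j, hj, rfl⟩
      change B ((A ^ j) v) ∈ krylov A v k
      rw [hBw]
      exact krylov_mono _ _ (Nat.lt_succ_iff.mp hj) ((apply_pow_sub_mem_krylov σ I f hv x j).1 y)
  have hfact (k : ℕ) : (B ^ k) ((A ^ k) v) = ((k.factorial : ℂ) * (-c) ^ k) • v := by
    induction k with
    | zero => simp
    | succ k ih =>
      have h1 := hBk k _ ((apply_pow_sub_mem_krylov σ I f hv x k).2 y)
      rw [← hBw, map_add, map_smul, ih, add_eq_zero_iff_eq_neg, ← neg_smul] at h1
      rw [pow_succ, mul_apply_eq_comp, h1, smul_smul, Nat.factorial_succ]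
      congr 1
      push_cast
      ring
  by_contra hc0
  have hbound (k : ℕ) : 1 ≤ (‖B‖ * ‖A‖ / ‖c‖) ^ k / (k.factorial : ℝ) := by
    have h1 : ‖(B ^ k) ((A ^ k) v)‖ ≤ ‖B‖ ^ k * (‖A‖ ^ k * ‖v‖) := by
      refine ((B ^ k).le_opNorm _).trans ?_
      gcongr
      · exact norm_pow_le B k
      · refine ((A ^ k).le_opNorm _).trans ?_
        gcongr
        exact norm_pow_le A k
    rw [hfact, norm_smul, norm_mul, norm_pow, norm_neg, Complex.norm_natCast, ← mul_assoc] at h1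
    have h2 := le_of_mul_le_mul_right h1 (norm_pos_iff.mpr hv0)
    have hcpos : 0 < ‖c‖ := norm_pos_iff.mpr hc0
    rw [div_pow, mul_pow, div_div, one_le_div (by positivity), mul_comm]
    exact h2
  have hlim := FloorSemiring.tendsto_pow_div_factorial_atTop (‖B‖ * ‖A‖ / ‖c‖)
  exact absurd (ge_of_tendsto' hlim hbound) (by norm_num)

variable [CompleteSpace F]

/-- The inductive step of Lie's theorem: a weight vector of an ideal `I` of codimension one gives
an approximate weight of `L`. -/
theorem exists_isApproxWeight_of_lieIdeal (σ : L →ₗ⁅ℂ⁆ (F →L[ℂ] F)) (I : LieIdeal ℂ L)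
    (hI : IsCoatom I.toSubmodule) (f : Module.Dual ℂ I) {v : F} (hv0 : v ≠ 0)
    (hv : ∀ y : I, σ y v = f y • v) : ∃ g, IsApproxWeight σ g := by
  obtain ⟨z, -, hz⟩ := SetLike.exists_of_lt hI.lt_top
  have hcompl : IsCompl I.toSubmodule (ℂ ∙ z) :=
    Submodule.isCompl_span_singleton_of_isCoatom_of_notMem hI hz
  let V : Submodule ℂ F := ⨅ y : I, (σ y - f y • ContinuousLinearMap.id ℂ F).ker
  have mem_V {w : F} : w ∈ V ↔ ∀ y : I, σ y w = f y • w := by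
    simp [V, sub_eq_zero]
  have hVclosed : IsClosed (V : Set F) := by
    rw [Submodule.coe_iInf]
    exact isClosed_iInter fun y ↦ ContinuousLinearMap.isClosed_ker _
  have : CompleteSpace V := hVclosed.completeSpace_coe
  have : Nontrivial V := ⟨⟨v, mem_V.mpr hv⟩, 0, fun h ↦ hv0 (congrArg Subtype.val h)⟩
  have hinv : ∀ w ∈ V, σ z w ∈ V := by
    intro w hw
    rw [mem_V] at hw ⊢
    intro y
    have hlie : σ (⁅z, y⁆ : I) = ⁅σ z, σ y⁆ := by rw [← LieHom.map_lie]; rfl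
    have h1 := hw ⁅z, y⁆
    rw [weight_lie_eq_zero σ I f hv0 hv, zero_smul, hlie, Ring.lie_def, sub_apply,
      mul_apply_eq_comp, mul_apply_eq_comp, hw, map_smul, sub_eq_zero] at h1
    exact h1.symm
  obtain ⟨μ, hμ⟩ := exists_approx_eigenvector ((σ z).restrict hinv)
  let e : (ℂ ∙ z) ≃ₗ[ℂ] ℂ :=
    (LinearEquiv.toSpanNonzeroSingleton ℂ L z (by rintro rfl; exact hz (zero_mem _))).symm
  -- The components of `x = π₁ x + π₂ x • z` along `I` and `z`.
  let π₁ : L →ₗ[ℂ] I := I.toSubmodule.projectionOnto (ℂ ∙ z) hcompl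
  let π₂ : L →ₗ[ℂ] ℂ := e.toLinearMap ∘ₗ (ℂ ∙ z).projectionOnto I.toSubmodule hcompl.symm
  have hπ (x : L) : x = π₁ x + π₂ x • z := by
    have h1 := Submodule.projection_add_projection_eq_self hcompl x
    have h2 : π₂ x • z = (ℂ ∙ z).projectionOnto I.toSubmodule hcompl.symm x := by
      simp [π₂, e]
    rw [h2]
    exact h1.symm
  refine ⟨f ∘ₗ π₁ + μ • π₂, fun s ε hε ↦ ?_⟩
  let M : ℝ := ∑ x ∈ s, ‖π₂ x‖
  have hM : 0 ≤ M := Finset.sum_nonneg fun _ _ ↦ norm_nonneg _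
  obtain ⟨⟨w, hwV⟩, hw0, hw⟩ := hμ (ε / (M + 1)) (by positivity)
  refine ⟨w, fun h ↦ hw0 (Subtype.ext h), fun x hx ↦ ?_⟩
  have hw : ‖σ z w - μ • w‖ ≤ ε / (M + 1) * ‖w‖ := hw
  have hx' : σ x w - (f ∘ₗ π₁ + μ • π₂) x • w = π₂ x • (σ z w - μ • w) := by
    conv_lhs => rw [hπ x]
    rw [map_add, map_smul, add_apply, smul_apply, mem_V.mp hwV, ← hπ x]
    simp only [LinearMap.add_apply, LinearMap.comp_apply, LinearMap.smul_apply, smul_eq_mul]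
    module
  have hxM : ‖π₂ x‖ ≤ M + 1 :=
    (Finset.single_le_sum (f := fun x ↦ ‖π₂ x‖) (fun _ _ ↦ norm_nonneg _) hx).trans (by linarith)
  rw [hx', norm_smul]
  calc ‖π₂ x‖ * ‖σ z w - μ • w‖ ≤ (M + 1) * (ε / (M + 1) * ‖w‖) := by gcongr
    _ = ε * ‖w‖ := by field_simp

end ApproxWeight

/-- Lie's theorem for bounded representations on Banach spaces. The Banach space varies in the
induction, since each step passes to bounded sequences modulo null sequences. -/
theorem exists_isApproxWeight {L : Type*} [LieRing L] [LieAlgebra ℂ L] [FiniteDimensional ℂ L]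
    [LieAlgebra.IsSolvable L] {F : Type*} [NormedAddCommGroup F] [NormedSpace ℂ F]
    [CompleteSpace F] [Nontrivial F] (σ : L →ₗ⁅ℂ⁆ (F →L[ℂ] F)) :
    ∃ f, IsApproxWeight σ f := by
  obtain H | ⟨I, hI, hIL⟩ :=
    eq_top_or_exists_le_coatom (LieAlgebra.derivedSeries ℂ L 1).toSubmodule
  · obtain _ | _ := subsingleton_or_nontrivial L
    · obtain ⟨v, hv⟩ := exists_ne (0 : F)
      refine ⟨0, fun s ε hε ↦ ⟨v, hv, fun x _ ↦ ?_⟩⟩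
      simp only [Subsingleton.elim x 0, map_zero, zero_apply, zero_smul, sub_self, norm_zero]
      positivity
    · rw [LieSubmodule.toSubmodule_eq_top] at H
      exact ((LieAlgebra.derivedSeries_lt_top_of_solvable ℂ L).ne H).elim
  lift I to LieIdeal ℂ L
  · intros
    exact hIL <| LieSubmodule.lie_mem_lie (LieSubmodule.mem_top _) (LieSubmodule.mem_top _)
  let ι : I →ₗ⁅ℂ⁆ L :=
    { I.toSubmodule.subtype with map_lie' := rfl }
  obtain ⟨f, hf⟩ := exists_isApproxWeight (σ.comp ι)
  obtain ⟨q, hq, hqI⟩ := hf.exists_eigenvector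
  obtain ⟨g, hg⟩ := exists_isApproxWeight_of_lieIdeal (germRep σ) I hI f hq hqI
  exact ⟨g, hg.of_germs⟩
termination_by Module.finrank ℂ L
decreasing_by
  rw [← finrank_top ℂ L]
  exact Submodule.finrank_lt_finrank_of_lt hI.lt_top

/-! ### Homology in degree zero -/

section Homology

variable {L : Type*} [LieRing L] [LieAlgebra ℂ L]
variable {E : Type*} [NormedAddCommGroup E] [NormedSpace ℂ E]

/-- The transposed representation `x ↦ (φ ↦ φ ∘ ρ(x))` on the dual of `E`. -/
noncomputable def dualRep (ρ : L →ₗ⁅ℂ⁆ (E →L[ℂ] E)ᵐᵒᵖ) :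
    L →ₗ⁅ℂ⁆ (StrongDual ℂ E →L[ℂ] StrongDual ℂ E) where
  toFun x := (ContinuousLinearMap.compL ℂ E E ℂ).flip (ρ x).unop
  map_add' x y := by simp
  map_smul' c x := by simp
  map_lie' {x y} := by
    ext φ e
    simp [Ring.lie_def]

@[simp]
theorem dualRep_apply (ρ : L →ₗ⁅ℂ⁆ (E →L[ℂ] E)ᵐᵒᵖ) (x : L) (φ : StrongDual ℂ E) (e : E) :
    dualRep ρ x φ e = φ ((ρ x).unop e) := rfl

/-- If `H₀(L, E ⊗ ℂ(f))` vanishes, then the operators `ρ(x) - f(x)` for `x` in a basis of `L` are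
jointly surjective. -/
theorem surjective_of_subsingleton_homology_zero {ι : Type*} [Fintype ι] (b : Module.Basis ι ℂ L)
    (ρ : L →ₗ⁅ℂ⁆ (E →L[ℂ] E)ᵐᵒᵖ) (f : Module.Dual ℂ L) (h : Subsingleton (Homology ρ f 0)) (e : E) :
    ∃ w : ι → E, ∑ i, ((ρ (b i)).unop (w i) - f (b i) • w i) = e := by
  let T : (ι → E) →ₗ[ℂ] E :=
    ∑ i, ((ρ (b i)).unop.toLinearMap - f (b i) • LinearMap.id) ∘ₗ LinearMap.proj i
  have hT (w : ι → E) : T w = ∑ i, ((ρ (b i)).unop (w i) - f (b i) • w i) := by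
    simp [T]
  -- The identification `E ⊗ ⋀⁰ L = E`.
  let κ : E ⊗[ℂ] ⋀[ℂ]^0 L →ₗ[ℂ] E :=
    (TensorProduct.rid ℂ E).toLinearMap ∘ₗ (exteriorPower.zeroEquiv ℂ L).toLinearMap.lTensor E
  have hκ (e : E) : κ (e ⊗ₜ exteriorPower.ιMulti ℂ 0 Fin.elim0) = e := by
    simp [κ, exteriorPower.zeroEquiv_ιMulti]
  have hx (e : E) (x : L) : (ρ x).unop e - f x • e ∈ LinearMap.range T := by
    let l : L →ₗ[ℂ] E := (twistedAction ρ f) ∘ₗ TensorProduct.mk ℂ E L e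
    suffices (LinearMap.range T).comap l = ⊤ from
      Submodule.mem_comap.mp (this ▸ Submodule.mem_top : x ∈ (LinearMap.range T).comap l)
    rw [eq_top_iff, ← b.span_eq, Submodule.span_le]
    rintro _ ⟨i, rfl⟩
    classical
    refine ⟨Pi.single i e, ?_⟩
    rw [hT, Finset.sum_eq_single i]
    · simp [l]
    · intro j _ hj
      simp [Pi.single_eq_of_ne hj]
    · simp
  have hd (t : E ⊗[ℂ] ⋀[ℂ]^1 L) : κ (boundary ρ f 0 t) ∈ LinearMap.range T := by
    induction t using TensorProduct.induction_on with
    | zero => simp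
    | add s t hs ht => simpa using add_mem hs ht
    | tmul e ω =>
      let l : ⋀[ℂ]^1 L →ₗ[ℂ] E := κ ∘ₗ boundary ρ f 0 ∘ₗ TensorProduct.mk ℂ E _ e
      suffices (LinearMap.range T).comap l = ⊤ from
        Submodule.mem_comap.mp (this ▸ Submodule.mem_top : ω ∈ (LinearMap.range T).comap l)
      rw [eq_top_iff, ← exteriorPower.ιMulti_span, Submodule.span_le]
      rintro _ ⟨x, rfl⟩
      change κ (boundary ρ f 0 (e ⊗ₜ _)) ∈ LinearMap.range T
      rw [boundary_zero_tmul, hκ]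
      exact hx _ _
  have htop := Submodule.Quotient.subsingleton_iff.mp h
  have hmem : (⟨e ⊗ₜ exteriorPower.ιMulti ℂ 0 Fin.elim0, Submodule.mem_top⟩ : cycles ρ f 0) ∈
      (LinearMap.range (boundary ρ f 0)).submoduleOf (cycles ρ f 0) := htop ▸ Submodule.mem_top
  obtain ⟨t, ht⟩ := hmem
  obtain ⟨w, hw⟩ := hd t
  refine ⟨w, ?_⟩
  rw [← hT, hw, ht]
  exact hκ e

variable [CompleteSpace E]

theorem nontrivial_homology_zero_of_isApproxWeight [FiniteDimensional ℂ L]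
    (ρ : L →ₗ⁅ℂ⁆ (E →L[ℂ] E)ᵐᵒᵖ) (f : Module.Dual ℂ L) (h : IsApproxWeight (dualRep ρ) f) :
    Nontrivial (Homology ρ f 0) := by
  classical
  by_contra hnot
  rw [not_nontrivial_iff_subsingleton] at hnot
  let b := Module.finBasis ℂ L
  let T : (Fin (Module.finrank ℂ L) → E) →L[ℂ] E :=
    ∑ i, ((ρ (b i)).unop - f (b i) • ContinuousLinearMap.id ℂ E) ∘L
      ContinuousLinearMap.proj (R := ℂ) i
  have hT (w) : T w = ∑ i, ((ρ (b i)).unop (w i) - f (b i) • w i) := by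
    simp [T]
  obtain ⟨C, hC, hpre⟩ := T.exists_preimage_norm_le fun e ↦ by
    simpa only [hT] using surjective_of_subsingleton_homology_zero b ρ f hnot e
  set n : ℝ := (Module.finrank ℂ L : ℝ)
  -- With this relative error the estimate below reads `‖φ‖ ≤ n / (n + 1) * ‖φ‖`.
  set ε : ℝ := ((n + 1) * C)⁻¹ with hε
  have hε0 : 0 < ε := by positivity
  obtain ⟨φ, hφ0, hφ⟩ := h (Finset.univ.image b) ε hε0
  have hbound : ‖φ‖ ≤ n * (ε * C) * ‖φ‖ := by
    refine φ.opNorm_le_bound (by positivity) fun e ↦ ?_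
    obtain ⟨w, rfl, hw⟩ := hpre e
    have hφT : φ (T w) = ∑ i, (dualRep ρ (b i) φ - f (b i) • φ) (w i) := by
      simp [hT]
    calc ‖φ (T w)‖ ≤ ∑ i, ‖(dualRep ρ (b i) φ - f (b i) • φ) (w i)‖ := by
          rw [hφT]; exact norm_sum_le _ _
      _ ≤ ∑ _i : Fin (Module.finrank ℂ L), ε * ‖φ‖ * (C * ‖T w‖) := by
          refine Finset.sum_le_sum fun i _ ↦ (ContinuousLinearMap.le_opNorm _ _).trans ?_
          gcongr
          · exact hφ _ (by simp)
          · exact (norm_le_pi_norm w i).trans hw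
      _ = n * (ε * C) * ‖φ‖ * ‖T w‖ := by
          rw [Finset.sum_const, Finset.card_univ, Fintype.card_fin, nsmul_eq_mul]
          ring
  have hεC : n * (ε * C) = n / (n + 1) := by
    rw [hε]; field_simp
  have hφpos : 0 < ‖φ‖ := norm_pos_iff.mpr hφ0
  have hlt : n / (n + 1) < 1 := by
    rw [div_lt_one (by positivity)]; linarith
  rw [hεC] at hbound
  nlinarith

end Homology

end LieSpectrum

theorem theorem5 {L : Type*} [LieRing L] [LieAlgebra ℂ L] [FiniteDimensional ℂ L]
    [LieAlgebra.IsSolvable L]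
    {E : Type*} [NormedAddCommGroup E] [NormedSpace ℂ E] [CompleteSpace E] [Nontrivial E]
    (ρ : L →ₗ⁅ℂ⁆ (E →L[ℂ] E)ᵐᵒᵖ) :
    (LieSpectrum.jointSpectrum ρ).Nonempty := by
  obtain ⟨f, hf⟩ := LieSpectrum.exists_isApproxWeight (LieSpectrum.dualRep ρ)
  exact ⟨f, hf.apply_lie, 0, LieSpectrum.nontrivial_homology_zero_of_isApproxWeight ρ f hf⟩
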